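/- Let $0\le q\le r\le m$ be integers. Index $2^m$ qubits by the vertices $x\in\mathbb Z_2^m$ of the $m$-dimensional hypercube and put $S=\{1,\dots,m\}$. For $J\subseteq S$ let $\langle J\rangle\subseteq\mathbb Z_2^m$ be the set of bit strings supported in $J$ (a standard subcube); an $\ell$-cube is a coset $x+\langle J\rangle$ with $|J|=\ell$, and $e_J\in\mathbb Z_2^m$ is the incidence string of $J$. For a single-qubit operator $U$ and a set $A$ of vertices, $U_A$ acts as $U$ on the qubits in $A$ and as the identity on the others. The quantum Reed–Muller code $QRM_m(q,r)$ is the common $+1$ eigenspace of the group generated by the operators $X_A$ for all $(m-q)$-cubes $A$ and $Z_A$ for all $(r+1)$-cubes $A$. Its logical qubits are indexed by $\mathcal Q=\{J\subseteq S: q+1\le |J|\le r\}$, the $J$-th one being given by the logical Pauli operators $\overline Z_J=Z_{\langle J\rangle}$ and $\overline X_J=X_{e_J+\langle S\setminus J\rangle}$. A bar over an operator on the register of logical qubits denotes its logical version with respect to these Pauli operators. For an integer $k\ge 0$ let $Z(k)=|0\rangle\langle 0|+e^{i\pi/2^k}|1\rangle\langle 1|$, and let $\widetilde Z(k)_A$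 be the operator that acts as $Z(k)$ on the qubits $x\in A$ of even Hamming weight, as $Z(k)^\dagger$ on the qubits $x\in A$ of odd Hamming weight, and as the identity on the other qubits. Let $\mathcal Q_k=\{K\subseteq S: q+kr+1\le|K|\le (k+1)r\}$. For $K\in\mathcal Q_k$ let $\mathcal F(K)$ be the collection of all sets $\mathcal J\subseteq\mathcal Q$ of exactly $k+1$ logical-qubit indices with $\bigcup_{J\in\mathcal J}J=K$. For a nonempty $\mathcal J\subseteq\mathcal Q$ let $C^{\mathcal J}Z$ be the gate on the register of logical qubits that multiplies by $-1$ the computational basis states in which all qubits of $\mathcal J$ are $1$ and fixes the other basis states, and let $C^{\mathcal F(K)}Z=\prod_{\mathcal J\in\mathcal F(K)}C^{\mathcal J}Z$. **Theorem.** For every $k\ge 0$ and every $K\in\mathcal Q_k$, the operator $\widetilde Z(k)_{\langle K\rangle}$ is logically equivalent to the multi-controlled-$Z$ circuit $\overline{C^{\mathcal F(K)}Z}$ on $QRM_m(q,r)$: both operators map the code space onto itself, and $\widetilde Z(k)_{\langle K\rangle}|\psi\rangle=\overline{C^{\mathcal F(K)}Z}\,|\psi\rangle$ for every code state $|\psi\rangle$.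 -/

import Mathlib

open scoped Matrix

noncomputable section

namespace QRM

/-! ### The hypercube and its subcubes -/

/-- Vertices of the `m`-dimensional hypercube: bit strings of length `m`. -/
abbrev Cube (m : ℕ) : Type := Fin m → ZMod 2

/-- The standard subcube generated by the `e_i`, `i ∈ J`: the bit strings supported inside `J`. -/
def standardCube {m : ℕ} (J : Finset (Fin m)) : Finset (Cube m) :=
  Finset.univ.filter fun y => ∀ i, i ∉ J → y i = 0

/-- The subcube (coset) `x + ⟨J⟩`, of type `J` and dimension `|J|`. -/
def subcube {m : ℕ} (x : Cube m) (J : Finset (Fin m)) : Finset (Cube m) :=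
  (standardCube J).image fun y => x + y

/-- The incidence bit string `e_J = ∑_{i ∈ J} e_i`. -/
def incidence {m : ℕ} (J : Finset (Fin m)) : Cube m := ∑ i ∈ J, Pi.single i 1

/-! ### Operators on `2 ^ m` qubits, indexed by the vertices of the hypercube -/

/-- Computational basis labels of the system with one qubit on each vertex. -/
abbrev Config (m : ℕ) : Type := Cube m → Fin 2

/-- State vectors, i.e. elements of `(ℂ²)^{⊗ 2^m}` in the computational basis. -/
abbrev State (m : ℕ) : Type := Config m → ℂ

/-- Operators on the `2 ^ m` qubits. -/
abbrev Op (m : ℕ) : Type := Matrix (Config m) (Config m) ℂ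

/-- The tensor product of the single-qubit operators `U x`. -/
def transversal {m : ℕ} (U : Cube m → Matrix (Fin 2) (Fin 2) ℂ) : Op m :=
  Matrix.of fun s t => ∏ x, U x (s x) (t x)

/-- The operator `U_A` acting as `U` on the qubits in `A` and as the identity elsewhere. -/
def onCube {m : ℕ} (U : Matrix (Fin 2) (Fin 2) ℂ) (A : Finset (Cube m)) : Op m :=
  transversal fun x => if x ∈ A then U else 1

/-- The Pauli matrix `X`. -/
def pauliX : Matrix (Fin 2) (Fin 2) ℂ := !![0, 1; 1, 0]

/-- The Pauli matrix `Z`. -/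
def pauliZ : Matrix (Fin 2) (Fin 2) ℂ := !![1, 0; 0, -1]

/-- The rotation `Z(k) = |0⟩⟨0| + exp (i π / 2 ^ k) |1⟩⟨1|`. -/
def zRot (k : ℕ) : Matrix (Fin 2) (Fin 2) ℂ :=
  !![1, 0; 0, Complex.exp (Complex.I * (Real.pi : ℂ) / (2 : ℂ) ^ k)]

/-- The signed operator on `A`: it acts as `Z(k)` on the qubits of `A` of even Hamming weight, as
`Z(k)†` on the qubits of `A` of odd Hamming weight, and as the identity elsewhere. -/
def signedZ {m : ℕ} (k : ℕ) (A : Finset (Cube m)) : Op m :=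
  transversal fun x =>
    if x ∈ A then (if Even (hammingNorm x) then zRot k else (zRot k)ᴴ) else 1

/-! ### The quantum Reed-Muller code -/

/-- The stabilizer generators: `X_A` for `(m - q)`-cubes `A`, and `Z_A` for `(r + 1)`-cubes `A`. -/
def stabilizerGenerators (m q r : ℕ) : Set (Op m) :=
  {S | ∃ (x : Cube m) (J : Finset (Fin m)), J.card = m - q ∧ S = onCube pauliX (subcube x J)} ∪
  {S | ∃ (x : Cube m) (J : Finset (Fin m)), J.card = r + 1 ∧ S = onCube pauliZ (subcube x J)}

/-- The stabilizer group. The generators are involutions, so the monoid they generate is the group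
they generate. -/
def stabilizerGroup (m q r : ℕ) : Submonoid (Op m) :=
  Submonoid.closure (stabilizerGenerators m q r)

/-- The code space of `QRM_m(q,r)`: the common `+1` eigenspace of the stabilizer group. -/
def codeSpace (m q r : ℕ) : Submodule ℂ (State m) where
  carrier := {ψ | ∀ S ∈ stabilizerGroup m q r, S *ᵥ ψ = ψ}
  add_mem' := by
    intro a b ha hb S hS
    rw [Matrix.mulVec_add, ha S hS, hb S hS]
  zero_mem' := by
    intro S _
    exact Matrix.mulVec_zero S
  smul_mem' := by
    intro c a ha S hS
    rw [Matrix.mulVec_smul, ha S hS]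

/-! ### Logical qubits -/

/-- The index set of the logical qubits: sets `J` of generators with `q + 1 ≤ |J| ≤ r`. -/
abbrev LogicalQubit (m q r : ℕ) : Type :=
  {J : Finset (Fin m) // q + 1 ≤ J.card ∧ J.card ≤ r}

/-- The logical Pauli operator `Z_{⟨J⟩}` of the `J`-th logical qubit. -/
def logicalZ {m : ℕ} (J : Finset (Fin m)) : Op m := onCube pauliZ (standardCube J)

/-- The logical Pauli operator `X_{e_J + ⟨S \ J⟩}` of the `J`-th logical qubit. -/
def logicalX {m : ℕ} (J : Finset (Fin m)) : Op m := onCube pauliX (subcube (incidence J) Jᶜ)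

/-- Computational basis labels of the register of logical qubits. -/
abbrev Register (m q r : ℕ) : Type := LogicalQubit m q r → Fin 2

theorem transversal_mul {m : ℕ} (U V : Cube m → Matrix (Fin 2) (Fin 2) ℂ) :
    transversal U * transversal V = transversal fun x => U x * V x := by
  ext s t
  simp only [transversal, Matrix.mul_apply, Matrix.of_apply, ← Finset.prod_mul_distrib]
  rw [Finset.prod_univ_sum, Fintype.piFinset_univ]

theorem onCube_commute {m : ℕ} (U : Matrix (Fin 2) (Fin 2) ℂ) (A B : Finset (Cube m)) :
    Commute (onCube U A) (onCube U B) := by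
  unfold Commute SemiconjBy onCube
  rw [transversal_mul, transversal_mul]
  congr 1
  funext x
  split_ifs <;> simp

/-- The projector `(1 + Z̄_J) / 2` onto the `+1` eigenspace of the logical `Z` of qubit `J`. -/
def logicalZeroProj {m : ℕ} (J : Finset (Fin m)) : Op m := (1 / 2 : ℂ) • (1 + logicalZ J)

theorem logicalZeroProj_commute {m : ℕ} (J J' : Finset (Fin m)) :
    Commute (logicalZeroProj J) (logicalZeroProj J') :=
  Commute.smul_left (Commute.smul_right
    (Commute.add_left (Commute.one_left _)
      (Commute.add_right (Commute.one_right _) (onCube_commute _ _ _))) _) _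

/-- The logical operator `|0…0⟩⟨0…0|`: the product of all the projectors `(1 + Z̄_J) / 2`. -/
def logicalZeroState (m q r : ℕ) : Op m :=
  (Finset.univ : Finset (LogicalQubit m q r)).noncommProd (fun J => logicalZeroProj J.1)
    fun J _ J' _ _ => logicalZeroProj_commute J.1 J'.1

/-- The logical operator `∏_J X̄_J ^ {b_J}`, flipping the logical qubits with `b_J = 1`. -/
def logicalFlip {m q r : ℕ} (b : Register m q r) : Op m :=
  (Finset.univ : Finset (LogicalQubit m q r)).noncommProd (fun J => logicalX J.1 ^ (b J : ℕ))
    fun _ _ _ _ _ => (onCube_commute pauliX _ _).pow_pow _ _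

/-- The logical operator `|a⟩⟨b|`, expressed through the logical Pauli operators. -/
def logicalMatrixUnit {m q r : ℕ} (a b : Register m q r) : Op m :=
  logicalFlip a * logicalZeroState m q r * (logicalFlip b)ᴴ

/-- The logical version of an operator `G` on the register of logical qubits: the operator that acts
on the code space as `∑ G_{ab} |a⟩⟨b|`, in the logical qubits given by the pairs `(Z̄_J, X̄_J)`. -/
def logicalOp {m q r : ℕ} (G : Matrix (Register m q r) (Register m q r) ℂ) : Op m :=
  ∑ a, ∑ b, G a b • logicalMatrixUnit a b

/-! ### Multi-controlled-`Z` circuits and minimal covers -/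

/-- The multi-controlled-`Z` gate on the qubits in `s`: it applies the phase `-1` to the basis states
which are `1` on all of `s`, and fixes the others. It is the identity for `s = ∅`, by convention. -/
def controlledZ {ι : Type} [Fintype ι] [DecidableEq ι] (s : Finset ι) :
    Matrix (ι → Fin 2) (ι → Fin 2) ℂ :=
  Matrix.diagonal fun b => if s.Nonempty ∧ ∀ i ∈ s, b i = 1 then -1 else 1

theorem controlledZ_commute {ι : Type} [Fintype ι] [DecidableEq ι] (s t : Finset ι) :
    Commute (controlledZ s) (controlledZ t) := by
  unfold Commute SemiconjBy controlledZ
  simp only [Matrix.diagonal_mul_diagonal, mul_comm]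

/-- The circuit consisting of the gates `controlledZ s`, `s ∈ F`. -/
def controlledZCircuit {ι : Type} [Fintype ι] [DecidableEq ι] (F : Finset (Finset ι)) :
    Matrix (ι → Fin 2) (ι → Fin 2) ℂ :=
  F.noncommProd controlledZ fun s _ t _ _ => controlledZ_commute s t

/-- The index set of the `k`-th level logical operators. -/
def levelIndex (m q r k : ℕ) : Set (Finset (Fin m)) :=
  {K | q + k * r + 1 ≤ K.card ∧ K.card ≤ (k + 1) * r}

/-- The minimal covers of a `k`-th level index `K`: the sets of `k + 1` logical qubits whose indices
have union `K`. -/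
def minimalCovers {m : ℕ} (q r k : ℕ) (K : Finset (Fin m)) :
    Finset (Finset (LogicalQubit m q r)) :=
  Finset.univ.filter fun 𝒥 => 𝒥.biUnion (fun J => J.1) = K ∧ 𝒥.card = k + 1

/-- Two operators are logically equivalent on the code `C` if both map `C` onto itself and they act
in the same way on every code state. -/
def LogicallyEquivalent {m : ℕ} (C : Submodule ℂ (State m)) (U V : Op m) : Prop :=
  C.map (Matrix.toLin' U) = C ∧ C.map (Matrix.toLin' V) = C ∧ ∀ ψ ∈ C, U *ᵥ ψ = V *ᵥ ψ

end QRM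

end

/-!
In the computational basis everything reduces to a congruence for polynomials over the field with
two elements. A configuration `s` of the `2 ^ m` qubits is a function on the cube `Z₂^m`, hence a
polynomial in `m` variables with at most linear dependence on each. Its coefficient at the monomial
of `J` is the parity of `s` on `⟨J⟩` (`coeff`, and `sum_coeff` for Möbius inversion). The `Z`
stabilizers force the configurations occurring in a code state to have degree at most `r`
(`coeff_eq_zero_of_mem_codeSpace`). The logical operators `X̄_J` add the monomial of `J`, and the
eigenvalue of `Z̄_J` is determined by the coefficient at `J`. So the logical version of a diagonal
operator is diagonal, with the entry at `s` depending only on the coefficients of `s` at the logical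
qubits (`logicalOp_diagonal`); it preserves the code space because the `X` stabilizers add
polynomials of degree at most `q`, which leave these coefficients unchanged
(`logicalBits_add_indicator`).

It remains to compare phases on a polynomial `s` of degree at most `r`. The phase of the signed
rotation on `⟨K⟩` is `exp (i π / 2 ^ k * M)` with `M` the alternating sum of `s` over `⟨K⟩`. Writing
`A` for the set of monomials of `s`, the value at `X` satisfies
`1 - 2 s(X) = ∏_{J ∈ A, J ⊆ X} (1 - 2) = ∑_{U ⊆ A, ⋃ U ⊆ X} (-2) ^ |U|`, and summing with signs over
`X ⊆ K` leaves `-2 M = ± ∑_{U ⊆ A, ⋃ U = K} (-2) ^ |U|` (`alternating_sum_eq_sum_covers`). As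
`|K| > k r`, every such `U` has at least `k + 1` members, so modulo `2 ^ (k + 1)` the number `M` is
`2 ^ k` times the number of covers of `K` by exactly `k + 1` monomials
(`exists_alternating_sum_eq`). As `|K| > q + k r`, each of these monomials has degree at least
`q + 1`, i.e. is a logical qubit (`card_covers_eq`). The phase is therefore the sign produced by the
circuit of multi-controlled `Z` gates.
-/

open scoped Matrix

noncomputable section

namespace QRM

/-! ### Subset sums -/

theorem fin_two_add_self (a : Fin 2) : a + a = 0 := by
  revert a; decide

theorem incidence_apply {m : ℕ} (T : Finset (Fin m)) (i : Fin m) :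
    incidence T i = if i ∈ T then 1 else 0 := by
  simp [incidence, Finset.sum_apply, Pi.single_apply]

theorem mem_standardCube {m : ℕ} {J : Finset (Fin m)} {x : Cube m} :
    x ∈ standardCube J ↔ ∀ i, i ∉ J → x i = 0 := by
  simp [standardCube]

theorem mem_subcube {m : ℕ} {x y : Cube m} {J : Finset (Fin m)} :
    y ∈ subcube x J ↔ ∀ i, i ∉ J → y i = x i := by
  simp only [subcube, Finset.mem_image, mem_standardCube]
  constructor
  · rintro ⟨z, hz, rfl⟩ i hi
    simp [hz i hi]
  · intro h
    exact ⟨y - x, fun i hi => by simp [h i hi], by simp⟩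

theorem sum_subcube {m : ℕ} {M : Type*} [AddCommMonoid M] (x : Cube m) (J : Finset (Fin m))
    (f : Cube m → M) : ∑ y ∈ subcube x J, f y = ∑ y ∈ standardCube J, f (x + y) :=
  Finset.sum_image fun _ _ _ _ h => add_left_cancel h

theorem sum_standardCube {m : ℕ} {M : Type*} [AddCommMonoid M] (J : Finset (Fin m))
    (f : Cube m → M) : ∑ x ∈ standardCube J, f x = ∑ T ∈ J.powerset, f (incidence T) := by
  symm
  refine Finset.sum_bij' (fun T _ => incidence T)
    (fun x _ => Finset.univ.filter fun i => x i = 1) ?_ ?_ ?_ ?_ ?_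
  · intro T hT
    rw [mem_standardCube]
    intro i hi
    rw [incidence_apply, if_neg fun h => hi (Finset.mem_powerset.1 hT h)]
  · intro x hx
    rw [mem_standardCube] at hx
    rw [Finset.mem_powerset]
    intro i hi
    by_contra h
    simp [hx i h] at hi
  · intro T _
    ext i
    simp [incidence_apply]
  · intro x _
    ext1 i
    have h : ∀ a : ZMod 2, (if a = 1 then 1 else 0) = a := by decide
    simp [incidence_apply, h]
  · intros
    rfl

theorem hammingNorm_incidence {m : ℕ} (T : Finset (Fin m)) : hammingNorm (incidence T) = T.card := by
  simp [hammingNorm, incidence_apply]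

/-- The sets between `L` and `K`, counted with the sign of their parity, cancel unless `L = K`. -/
theorem sum_neg_one_pow_card_between {α : Type*} [DecidableEq α] (L K : Finset α) :
    ∑ T ∈ K.powerset, (if L ⊆ T then (-1 : ℤ) ^ T.card else 0) =
      if L = K then (-1) ^ K.card else 0 := by
  split_ifs with h
  · subst h
    rw [Finset.sum_eq_single L]
    · simp
    · intro T hT hne
      rw [if_neg fun hL => hne (Finset.Subset.antisymm (Finset.mem_powerset.1 hT) hL)]
    · simp
  · by_cases hLK : L ⊆ K
    · obtain ⟨i, hiK, hiL⟩ : ∃ i ∈ K, i ∉ L := by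
        by_contra! hc
        exact h (Finset.Subset.antisymm hLK hc)
      -- Toggling `i` cancels the terms in pairs.
      obtain ⟨K', hi, rfl⟩ : ∃ K', i ∉ K' ∧ insert i K' = K :=
        ⟨K.erase i, Finset.notMem_erase i K, Finset.insert_erase hiK⟩
      rw [Finset.sum_powerset_insert hi, ← Finset.sum_add_distrib]
      refine Finset.sum_eq_zero fun T hT => ?_
      have hiT : i ∉ T := fun hh => hi (Finset.mem_powerset.1 hT hh)
      simp only [Finset.subset_insert_iff_of_notMem hiL, Finset.card_insert_of_notMem hiT]
      split_ifs <;> ring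
    · exact Finset.sum_eq_zero fun T hT =>
        if_neg fun hL => hLK (hL.trans (Finset.mem_powerset.1 hT))

/-- The number of sets between `L` and `K`, modulo two. -/
theorem sum_between_mod_two {α : Type*} [DecidableEq α] (L K : Finset α) :
    ∑ T ∈ K.powerset, (if L ⊆ T then (1 : Fin 2) else 0) = if L = K then 1 else 0 := by
  have h := congrArg (Int.castAddHom (ZMod 2)) (sum_neg_one_pow_card_between L K)
  rw [map_sum] at h
  have e : (-1 : ZMod 2) = 1 := by decide
  simp only [apply_ite (Int.castAddHom (ZMod 2)), Int.coe_castAddHom, Int.cast_pow, Int.cast_neg,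
    Int.cast_one, Int.cast_zero, e, one_pow] at h
  exact h

/-! ### Coefficients of the algebraic normal form -/

/-- The coefficient at the monomial `∏ i ∈ J, x i` of the polynomial over the field with two
elements that represents the configuration `s`, as a sum over a standard subcube. -/
def coeff {m : ℕ} (J : Finset (Fin m)) (s : Config m) : Fin 2 := ∑ x ∈ standardCube J, s x

/-- The configuration which is `1` exactly on `A`, that is, the one that `X_A` adds. -/
def indicator {m : ℕ} (A : Finset (Cube m)) : Config m := fun x => if x ∈ A then 1 else 0

theorem coeff_add {m : ℕ} (J : Finset (Fin m)) (s t : Config m) :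
    coeff J (s + t) = coeff J s + coeff J t := by
  simp [coeff, Finset.sum_add_distrib]

/-- Möbius inversion: a configuration is the sum of its monomials. -/
theorem sum_coeff {m : ℕ} (s : Config m) (X : Finset (Fin m)) :
    ∑ J ∈ X.powerset, coeff J s = s (incidence X) := by
  have h1 : ∀ J ∈ X.powerset, coeff J s =
      ∑ T ∈ X.powerset, if T ⊆ J then s (incidence T) else 0 := by
    intro J hJ
    rw [coeff, sum_standardCube, ← Finset.sum_filter]
    congr 1
    ext T
    simp only [Finset.mem_powerset, Finset.mem_filter] at hJ ⊢
    exact ⟨fun h => ⟨h.trans hJ, h⟩, fun h => h.2⟩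
  rw [Finset.sum_congr rfl h1, Finset.sum_comm]
  have h2 : ∀ T ∈ X.powerset, (∑ J ∈ X.powerset, if T ⊆ J then s (incidence T) else 0) =
      if T = X then s (incidence T) else 0 := by
    intro T _
    have h3 := sum_between_mod_two T X
    rcases (by decide : ∀ a : Fin 2, a = 0 ∨ a = 1) (s (incidence T)) with h | h
    · simp [h]
    · rw [h, h3]
  rw [Finset.sum_congr rfl h2]
  simp

/-- The support of the logical `X` of qubit `J` is the set where the monomial of `J` is one. -/
theorem indicator_logicalX_incidence {m : ℕ} (J T : Finset (Fin m)) :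
    indicator (subcube (incidence J) Jᶜ) (incidence T) = if J ⊆ T then 1 else 0 := by
  unfold indicator
  congr 1
  rw [mem_subcube]
  simp only [Finset.mem_compl, not_not, incidence_apply, eq_iff_iff]
  constructor
  · intro h i hi
    by_contra hT
    have := h i hi
    simp [hi, hT] at this
  · intro h i hi
    simp [hi, h hi]

/-- The supports of the logical operators `X` and `Z` are dual to each other. -/
theorem coeff_logicalX {m : ℕ} (J J' : Finset (Fin m)) :
    coeff J (indicator (subcube (incidence J') J'ᶜ)) = if J' = J then 1 else 0 := by
  rw [coeff, sum_standardCube, ← sum_between_mod_two]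
  simp only [indicator_logicalX_incidence]

/-- A standard subcube and a subcube sharing a direction meet in an even number of vertices. -/
theorem coeff_indicator_subcube {m : ℕ} {J J' : Finset (Fin m)} (x : Cube m)
    (h : (J ∩ J').Nonempty) : coeff J (indicator (subcube x J')) = 0 := by
  obtain ⟨i, hi⟩ := h
  rw [Finset.mem_inter] at hi
  have key : ∀ y : Cube m, y + Pi.single i 1 ∈ subcube x J' ↔ y ∈ subcube x J' := by
    intro y
    rw [mem_subcube, mem_subcube]
    refine forall₂_congr fun j hj => ?_
    have : j ≠ i := fun e => hj (e ▸ hi.2)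
    simp [this]
  refine Finset.sum_involution (fun y _ => y + Pi.single i 1) ?_ ?_ ?_ ?_
  · intro y _
    simp only [indicator, key]
    exact fin_two_add_self _
  · intro y _ _ e
    have := congrFun e i
    simp at this
  · intro y hy
    rw [mem_standardCube] at hy ⊢
    intro j hj
    have : j ≠ i := fun e => hj (e ▸ hi.1)
    simp [this, hy j hj]
  · intro y _
    have : (1 : ZMod 2) + 1 = 0 := by decide
    rw [add_assoc, ← Pi.single_add, this]
    simp

/-- A configuration with even parity on every `d`-cube has even parity on every cube of dimension
at least `d`, since a larger cube is a disjoint union of two parallel facets. -/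
theorem sum_subcube_eq_zero {m d : ℕ} {s : Config m}
    (hs : ∀ (x : Cube m) (J : Finset (Fin m)), J.card = d → ∑ y ∈ subcube x J, s y = 0)
    (J : Finset (Fin m)) (hJ : d ≤ J.card) (x : Cube m) : ∑ y ∈ subcube x J, s y = 0 := by
  induction J using Finset.induction_on generalizing x with
  | empty => exact hs x _ (le_antisymm (by simp) hJ)
  | insert i J hi ih =>
    rcases hJ.eq_or_lt with h | h
    · exact hs x _ h.symm
    · rw [Finset.card_insert_of_notMem hi] at h
      have e : ∀ T ∈ J.powerset, incidence (insert i T) = Pi.single i 1 + incidence T := by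
        intro T hT
        exact Finset.sum_insert fun hh => hi (Finset.mem_powerset.1 hT hh)
      have h0 := ih (by omega) x
      have h1 := ih (by omega) (x + Pi.single i 1)
      rw [sum_subcube, sum_standardCube] at h0 h1 ⊢
      rw [Finset.sum_powerset_insert hi, h0, zero_add,
        Finset.sum_congr rfl fun T hT => by rw [e T hT, ← add_assoc], h1]

/-! ### The congruence for alternating sums -/

/-- If the parity of `f X` is the number of `J ∈ A` inside `X`, then the alternating sum of
`1 - 2 * f X` over the subsets of `K` is a sum over the covers of `K` by members of `A`. It comes
from expanding `1 - 2 * f X = ∏ (1 - 2)`, the product being over the `J ∈ A` inside `X`. -/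
theorem alternating_sum_eq_sum_covers {α : Type*} [DecidableEq α] (A : Finset (Finset α))
    (K : Finset α) (f : Finset α → ℤ)
    (hf : ∀ X, 1 - 2 * f X = (-1) ^ (A.filter (· ⊆ X)).card) :
    ∑ X ∈ K.powerset, (-1) ^ X.card * (1 - 2 * f X) =
      (-1) ^ K.card * ∑ U ∈ A.powerset with U.biUnion id = K, (-2) ^ U.card := by
  have expand : ∀ X, (1 - 2 * f X) =
      ∑ U ∈ A.powerset, if U.biUnion id ⊆ X then (-2) ^ U.card else 0 := by
    intro X
    rw [hf, ← Finset.sum_filter]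
    have e : (A.powerset.filter fun U => U.biUnion id ⊆ X) = (A.filter (· ⊆ X)).powerset := by
      ext U
      simp only [Finset.mem_filter, Finset.mem_powerset, Finset.biUnion_subset, id]
      exact ⟨fun h J hJ => Finset.mem_filter.2 ⟨h.1 hJ, h.2 J hJ⟩,
        fun h => ⟨fun J hJ => (Finset.mem_filter.1 (h hJ)).1,
          fun J hJ => (Finset.mem_filter.1 (h hJ)).2⟩⟩
    rw [e]
    have := Finset.sum_pow_mul_eq_add_pow (-2 : ℤ) 1 (A.filter (· ⊆ X))
    simpa using this.symm
  simp only [expand, Finset.mul_sum]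
  rw [Finset.sum_comm, Finset.sum_filter]
  refine Finset.sum_congr rfl fun U _ => ?_
  have h := congrArg (· * (-2 : ℤ) ^ U.card) (sum_neg_one_pow_card_between (U.biUnion id) K)
  simp only [Finset.sum_mul, ite_mul, zero_mul] at h
  rw [← h]
  exact Finset.sum_congr rfl fun X _ => by split_ifs <;> simp

/-- If all members of `A` have at most `r` elements and `K` has more than `k * r`, then only the
covers of `K` by `k + 1` members of `A` matter modulo `2 ^ (k + 1)`. -/
theorem exists_alternating_sum_eq {α : Type*} [DecidableEq α] (A : Finset (Finset α))
    (K : Finset α) (f : Finset α → ℤ) {k r : ℕ}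
    (hf : ∀ X, 1 - 2 * f X = (-1) ^ (A.filter (· ⊆ X)).card)
    (hA : ∀ J ∈ A, J.card ≤ r) (hK : k * r < K.card) :
    ∃ w : ℤ, ∑ X ∈ K.powerset, (-1) ^ X.card * f X =
      2 ^ k * ((A.powerset.filter fun U => U.biUnion id = K ∧ U.card = k + 1).card + 2 * w) := by
  have hcard : ∀ U ∈ A.powerset.filter (fun U => U.biUnion id = K), k + 1 ≤ U.card := by
    intro U hU
    rw [Finset.mem_filter, Finset.mem_powerset] at hU
    have h1 : (U.biUnion id).card ≤ U.card * r :=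
      Finset.card_biUnion_le_card_mul U id r fun J hJ => hA J (hU.1 hJ)
    rw [hU.2] at h1
    exact Nat.lt_of_mul_lt_mul_right (hK.trans_le h1)
  set N : ℤ := ((A.powerset.filter fun U => U.biUnion id = K ∧ U.card = k + 1).card : ℤ) with hN
  obtain ⟨w, hw⟩ : ∃ w : ℤ, ∑ U ∈ A.powerset with U.biUnion id = K, (-2 : ℤ) ^ U.card =
      (-2) ^ (k + 1) * (N + 2 * w) := by
    -- A cover of `k + 2 + d` members contributes `(-2) ^ (k + 1) * 2 * -(-2) ^ d`.
    have h1 : ∀ U ∈ A.powerset.filter (fun U => U.biUnion id = K), (-2 : ℤ) ^ U.card =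
        (-2) ^ (k + 1) * ((if U.card = k + 1 then 1 else 0) +
          2 * (if U.card = k + 1 then 0 else -(-2) ^ (U.card - (k + 2)))) := by
      intro U hU
      split_ifs with h
      · simp [h]
      · have h2 := hcard U hU
        obtain ⟨d, hd⟩ : ∃ d, U.card = k + 2 + d := ⟨U.card - (k + 2), by omega⟩
        rw [hd, Nat.add_sub_cancel_left]
        ring
    refine ⟨∑ U ∈ A.powerset with U.biUnion id = K,
      (if U.card = k + 1 then 0 else -(-2) ^ (U.card - (k + 2))), ?_⟩
    rw [Finset.sum_congr rfl h1, ← Finset.mul_sum, Finset.sum_add_distrib, ← Finset.mul_sum,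
      Finset.sum_boole, Finset.filter_filter]
  have hne : K ≠ ∅ := by
    rintro rfl
    simp at hK
  have h := alternating_sum_eq_sum_covers A K f hf
  have h0 : ∑ X ∈ K.powerset, (-1 : ℤ) ^ X.card = 0 := by
    rw [Finset.sum_powerset_neg_one_pow_card, if_neg hne]
  simp only [mul_sub, mul_one, Finset.sum_sub_distrib, h0, zero_sub, hw] at h
  have h2 : ∑ X ∈ K.powerset, (-1 : ℤ) ^ X.card * (2 * f X) =
      2 * ∑ X ∈ K.powerset, (-1) ^ X.card * f X := by
    rw [Finset.mul_sum]
    exact Finset.sum_congr rfl fun X _ => by ring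
  rw [h2] at h
  have h3 : ∑ X ∈ K.powerset, (-1) ^ X.card * f X =
      (-1) ^ K.card * ((-1) ^ k * 2 ^ k * (N + 2 * w)) := by
    have e : (-2 : ℤ) ^ (k + 1) = -2 * ((-1) ^ k * 2 ^ k) := by
      rw [pow_succ, ← mul_pow]; ring
    rw [e] at h
    linarith
  rw [h3]
  rcases neg_one_pow_eq_or ℤ K.card with hs | hs <;> rcases neg_one_pow_eq_or ℤ k with ht | ht <;>
    rw [hs, ht]
  -- The sign is immaterial, since `-(N + 2 * w) = N + 2 * (-w - N)`.
  · exact ⟨w, by ring⟩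
  · exact ⟨-w - N, by ring⟩
  · exact ⟨-w - N, by ring⟩
  · exact ⟨w, by ring⟩


/-! ### Operators in the computational basis -/

theorem transversal_diagonal {m : ℕ} (d : Cube m → Fin 2 → ℂ) :
    transversal (fun x => Matrix.diagonal (d x)) = Matrix.diagonal fun s => ∏ x, d x (s x) := by
  ext s t
  simp only [transversal, Matrix.of_apply, Matrix.diagonal_apply]
  split_ifs with h
  · subst h
    simp
  · obtain ⟨x, hx⟩ := Function.ne_iff.1 h
    exact Finset.prod_eq_zero (Finset.mem_univ x) (if_neg hx)

/-- The operator that adds `v` to every configuration: the product of the Pauli `X` on the qubits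
where `v` is `1`. -/
def shift {m : ℕ} (v : Config m) : Op m := Matrix.of fun s t => if t = s + v then 1 else 0

theorem config_add_self {m : ℕ} (v : Config m) : v + v = 0 :=
  funext fun _ => fin_two_add_self _

theorem config_add_add_self {m : ℕ} (s v : Config m) : s + v + v = s := by
  rw [add_assoc, config_add_self, add_zero]

theorem shift_mulVec {m : ℕ} (v : Config m) (ψ : State m) : shift v *ᵥ ψ = fun s => ψ (s + v) := by
  ext s
  simp [shift, Matrix.mulVec, dotProduct]

theorem shift_zero {m : ℕ} : shift (0 : Config m) = 1 := by
  ext s t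
  simp [shift, Matrix.one_apply, eq_comm]

theorem shift_mul_shift {m : ℕ} (v w : Config m) : shift v * shift w = shift (v + w) := by
  ext s t
  simp only [shift, Matrix.mul_apply, Matrix.of_apply, ite_mul, one_mul, zero_mul,
    Finset.sum_ite_eq', Finset.mem_univ, if_true, add_assoc]

theorem shift_conjTranspose {m : ℕ} (v : Config m) : (shift v)ᴴ = shift v := by
  ext s t
  have : s = t + v ↔ t = s + v :=
    ⟨fun h => by rw [h, config_add_add_self], fun h => by rw [h, config_add_add_self]⟩
  simp only [shift, Matrix.conjTranspose_apply, Matrix.of_apply, this]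
  split_ifs <;> simp

theorem shift_mul_diagonal_mul_shift {m : ℕ} (v : Config m) (d : Config m → ℂ) :
    shift v * Matrix.diagonal d * shift v = Matrix.diagonal fun s => d (s + v) := by
  ext s t
  rw [Matrix.mul_apply]
  simp only [Matrix.mul_diagonal, shift, Matrix.of_apply, Matrix.diagonal_apply, ite_mul, one_mul,
    zero_mul, mul_ite, mul_one, mul_zero]
  rw [Finset.sum_eq_single (s + v)]
  · simp [config_add_add_self, eq_comm]
  · intro u _ hu
    simp [hu]
  · simp

theorem onCube_pauliX {m : ℕ} (A : Finset (Cube m)) : onCube pauliX A = shift (indicator A) := by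
  ext s t
  have key : ∀ x, (if x ∈ A then pauliX else 1) (s x) (t x) =
      if t x = s x + indicator A x then 1 else 0 := by
    intro x
    unfold indicator
    split_ifs with h <;> generalize s x = a at * <;> generalize t x = b at * <;>
      fin_cases a <;> fin_cases b <;> simp_all [pauliX]
  simp only [onCube, transversal, shift, Matrix.of_apply, key, Finset.prod_boole, Finset.mem_univ,
    true_imp_iff, funext_iff, Pi.add_apply]

theorem neg_one_pow_val_add (a b : Fin 2) :
    (-1 : ℤ) ^ ((a + b : Fin 2) : ℕ) = (-1) ^ (a : ℕ) * (-1) ^ (b : ℕ) := by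
  revert a b; decide

theorem neg_one_pow_val_sum {ι : Type*} (S : Finset ι) (f : ι → Fin 2) :
    (-1 : ℤ) ^ ((∑ x ∈ S, f x : Fin 2) : ℕ) = ∏ x ∈ S, (-1 : ℤ) ^ (f x : ℕ) := by
  classical
  induction S using Finset.induction_on with
  | empty => simp
  | insert i S hi ih => rw [Finset.sum_insert hi, Finset.prod_insert hi, neg_one_pow_val_add, ih]

theorem onCube_pauliZ {m : ℕ} (A : Finset (Cube m)) :
    onCube pauliZ A = Matrix.diagonal fun s => (-1) ^ ((∑ x ∈ A, s x : Fin 2) : ℕ) := by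
  have e : (fun x : Cube m => if x ∈ A then pauliZ else 1) = fun x =>
      Matrix.diagonal fun a : Fin 2 => if x ∈ A then (-1) ^ (a : ℕ) else 1 := by
    funext x
    split_ifs
    · ext a b
      fin_cases a <;> fin_cases b <;> simp [pauliZ]
    · simp
  rw [onCube, e, transversal_diagonal]
  congr 1
  funext s
  rw [Finset.prod_ite_mem, Finset.univ_inter]
  exact_mod_cast (congrArg (Int.cast : ℤ → ℂ) (neg_one_pow_val_sum A s)).symm

theorem signedZ_eq_diagonal {m : ℕ} (k : ℕ) (A : Finset (Cube m)) :
    signedZ k A = Matrix.diagonal fun s => Complex.exp (Complex.I * (Real.pi : ℂ) / (2 : ℂ) ^ k *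
      ((∑ x ∈ A, (-1) ^ hammingNorm x * ((s x : ℕ) : ℤ) : ℤ) : ℂ)) := by
  set θ : ℂ := Complex.I * (Real.pi : ℂ) / (2 : ℂ) ^ k with hθ
  have hconj : (starRingEnd ℂ) θ = -θ := by
    have h2 : (starRingEnd ℂ) 2 = 2 := Complex.conj_ofNat 2
    simp [hθ, neg_div, h2]
  have e : (fun x : Cube m => if x ∈ A then
      (if Even (hammingNorm x) then zRot k else (zRot k)ᴴ) else 1) = fun x =>
      Matrix.diagonal fun a : Fin 2 => if x ∈ A then
        Complex.exp (θ * ((-1) ^ hammingNorm x * ((a : ℕ) : ℂ))) else 1 := by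
    funext x
    split_ifs with _ h
    · rw [h.neg_one_pow]
      ext a b
      fin_cases a <;> fin_cases b <;> simp [zRot, hθ]
    · rw [(Nat.not_even_iff_odd.1 h).neg_one_pow]
      ext a b
      fin_cases a <;> fin_cases b <;>
        simp [zRot, ← hθ, Matrix.conjTranspose_apply, ← Complex.exp_conj, hconj]
    · simp
  rw [signedZ, e, transversal_diagonal]
  congr 1
  funext s
  rw [Finset.prod_ite_mem, Finset.univ_inter, ← Complex.exp_sum, ← Finset.mul_sum]
  push_cast
  rfl

/-! ### The code space -/

/-- The code states are the functions on configurations that are invariant under adding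
`(m - q)`-cubes and supported on the configurations of even parity on all `(r + 1)`-cubes. -/
theorem mem_codeSpace_iff {m q r : ℕ} {ψ : State m} :
    ψ ∈ codeSpace m q r ↔
      (∀ (x : Cube m) (J : Finset (Fin m)), J.card = m - q →
        ∀ s, ψ (s + indicator (subcube x J)) = ψ s) ∧
      (∀ (x : Cube m) (J : Finset (Fin m)), J.card = r + 1 →
        ∀ s, ψ s ≠ 0 → ∑ y ∈ subcube x J, s y = 0) := by
  have hgen : ψ ∈ codeSpace m q r ↔ ∀ S ∈ stabilizerGenerators m q r, S *ᵥ ψ = ψ := by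
    constructor
    · intro h S hS
      exact h S (Submonoid.subset_closure hS)
    · intro h S hS
      induction hS using Submonoid.closure_induction with
      | mem S hS => exact h S hS
      | one => exact Matrix.one_mulVec ψ
      | mul S T _ _ hS hT => rw [← Matrix.mulVec_mulVec, hT, hS]
  have hZ : ∀ (A : Finset (Cube m)), onCube pauliZ A *ᵥ ψ = ψ ↔
      ∀ s, ψ s ≠ 0 → ∑ y ∈ A, s y = 0 := by
    intro A
    rw [onCube_pauliZ, funext_iff]
    refine forall_congr' fun s => ?_
    rw [Matrix.mulVec_diagonal]
    rcases (by decide : ∀ a : Fin 2, a = 0 ∨ a = 1) (∑ y ∈ A, s y) with h | h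
    · simp [h]
    · simp [h, neg_eq_self]
  rw [hgen]
  constructor
  · intro h
    refine ⟨fun x J hJ s => ?_, fun x J hJ => (hZ _).1 (h _ (Or.inr ⟨x, J, hJ, rfl⟩))⟩
    have h1 := h _ (Or.inl ⟨x, J, hJ, rfl⟩)
    rw [onCube_pauliX, shift_mulVec] at h1
    exact congrFun h1 s
  · rintro ⟨hX, hZ'⟩ S (⟨x, J, hJ, rfl⟩ | ⟨x, J, hJ, rfl⟩)
    · rw [onCube_pauliX, shift_mulVec]
      exact funext (hX x J hJ)
    · exact (hZ _).2 (hZ' x J hJ)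

/-- The configurations occurring in a code state are polynomials of degree at most `r`. -/
theorem coeff_eq_zero_of_mem_codeSpace {m q r : ℕ} {ψ : State m} (hψ : ψ ∈ codeSpace m q r)
    {s : Config m} (hs : ψ s ≠ 0) {J : Finset (Fin m)} (hJ : r < J.card) : coeff J s = 0 := by
  have h := sum_subcube_eq_zero (s := s) (fun x J hJ => (mem_codeSpace_iff.1 hψ).2 x J hJ s hs) J hJ 0
  rw [sum_subcube] at h
  simpa [coeff] using h

/-- The basis label of the logical register read off from the coefficients of `s`: the logical qubit
`J` has the value of the coefficient at `J`, on which `Z̄_J` acts by the corresponding sign. -/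
def logicalBits {m : ℕ} (q r : ℕ) (s : Config m) : Register m q r := fun J => coeff J.1 s

/-- The `X` stabilizers do not change the values of the logical qubits: a `(q + 1)`-dimensional
set of directions and an `(m - q)`-dimensional one always share a direction. -/
theorem logicalBits_add_indicator {m q r : ℕ} (s : Config m) (x : Cube m) {J : Finset (Fin m)}
    (hJ : J.card = m - q) : logicalBits q r (s + indicator (subcube x J)) = logicalBits q r s := by
  funext L
  have hne : (L.1 ∩ J).Nonempty := by
    rw [← Finset.card_pos]
    have h1 := Finset.card_union_add_card_inter L.1 J
    have h2 : (L.1 ∪ J).card ≤ m := (Finset.card_le_univ _).trans (by simp)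
    have h3 := L.2.1
    omega
  rw [logicalBits, coeff_add, coeff_indicator_subcube x hne, add_zero, logicalBits]

/-! ### Logical diagonal operators -/

theorem noncommProd_eq_diagonal {ι n : Type*} [Fintype n] [DecidableEq n] (F : Finset ι)
    {M : ι → Matrix n n ℂ} {d : ι → n → ℂ} (hM : ∀ i, M i = Matrix.diagonal (d i)) (comm) :
    F.noncommProd M comm = Matrix.diagonal fun a => ∏ i ∈ F, d i a := by
  obtain rfl := funext hM
  have h := Finset.map_noncommProd F d (fun _ _ _ _ _ => Commute.all _ _)
    (Matrix.diagonalRingHom n ℂ)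
  rw [Finset.noncommProd_eq_prod] at h
  refine Eq.trans ?_ (h.symm.trans ?_)
  · rfl
  · simp only [Matrix.diagonalRingHom_apply]
    congr 1
    funext a
    rw [Finset.prod_apply]

theorem logicalZeroProj_eq_diagonal {m : ℕ} (J : Finset (Fin m)) :
    logicalZeroProj J = Matrix.diagonal fun s => if coeff J s = 0 then 1 else 0 := by
  rw [logicalZeroProj, logicalZ, onCube_pauliZ, ← Matrix.diagonal_one, Matrix.diagonal_add,
    ← Matrix.diagonal_smul]
  congr 1
  funext s
  change (1 / 2 : ℂ) * (1 + (-1) ^ (coeff J s : ℕ)) = _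
  rcases (by decide : ∀ a : Fin 2, a = 0 ∨ a = 1) (coeff J s) with h | h <;> norm_num [h]

theorem logicalZeroState_eq_diagonal (m q r : ℕ) :
    logicalZeroState m q r =
      Matrix.diagonal fun s => if logicalBits q r s = 0 then 1 else 0 := by
  have hM : ∀ J : LogicalQubit m q r, logicalZeroProj J.1 =
      Matrix.diagonal ((fun J s => if coeff J.1 s = 0 then 1 else 0 :
        LogicalQubit m q r → Config m → ℂ) J) := fun J => logicalZeroProj_eq_diagonal J.1
  refine (noncommProd_eq_diagonal Finset.univ hM _).trans ?_
  simp only [Finset.prod_boole]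
  congr 1
  funext s
  simp [funext_iff, logicalBits]

/-- The polynomial with the coefficients `b` at the logical qubits and no other monomials. -/
def logicalConfig {m q r : ℕ} (b : Register m q r) : Config m :=
  ∑ J, (b J : ℕ) • indicator (subcube (incidence J.1) J.1ᶜ)

theorem shift_nsmul {m : ℕ} (v : Config m) (n : ℕ) : shift (n • v) = shift v ^ n := by
  induction n with
  | zero => rw [zero_smul, shift_zero, pow_zero]
  | succ n ih => rw [add_smul, one_smul, ← shift_mul_shift, ih, pow_succ]

theorem logicalFlip_eq_shift {m q r : ℕ} (b : Register m q r) :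
    logicalFlip b = shift (logicalConfig b) := by
  let φ : Multiplicative (Config m) →* Op m :=
    { toFun := fun v => shift v.toAdd
      map_one' := shift_zero
      map_mul' := fun v w => (shift_mul_shift _ _).symm }
  have h := Finset.map_noncommProd (Finset.univ : Finset (LogicalQubit m q r))
    (fun J => Multiplicative.ofAdd ((b J : ℕ) • indicator (subcube (incidence J.1) J.1ᶜ)))
    (fun _ _ _ _ _ => Commute.all _ _) φ
  rw [Finset.noncommProd_eq_prod, ← ofAdd_sum] at h
  refine Eq.trans ?_ h.symm
  refine Finset.noncommProd_congr rfl (fun J _ => ?_) _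
  change _ = shift _
  rw [toAdd_ofAdd, shift_nsmul, logicalX, onCube_pauliX]

theorem logicalBits_logicalConfig {m q r : ℕ} (b : Register m q r) :
    logicalBits q r (logicalConfig b) = b := by
  funext L
  let φ : Config m →+ Fin 2 :=
    { toFun := coeff L.1
      map_zero' := by simp [coeff]
      map_add' := coeff_add L.1 }
  change φ (logicalConfig b) = b L
  rw [logicalConfig, map_sum, Finset.sum_eq_single L]
  · rw [map_nsmul]
    change (b L : ℕ) • coeff L.1 _ = _
    rw [coeff_logicalX, if_pos rfl]
    generalize b L = a
    revert a
    decide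
  · intro J _ hJ
    rw [map_nsmul]
    change (b J : ℕ) • coeff L.1 _ = _
    rw [coeff_logicalX, if_neg fun h => hJ (Subtype.ext h), smul_zero]
  · simp

theorem logicalBits_add {m q r : ℕ} (s t : Config m) :
    logicalBits q r (s + t) = logicalBits q r s + logicalBits q r t :=
  funext fun _ => coeff_add _ _ _

/-- The logical version of a diagonal operator multiplies a configuration by the diagonal entry at
the values of its logical qubits. -/
theorem logicalOp_diagonal {m q r : ℕ} (g : Register m q r → ℂ) :
    logicalOp (Matrix.diagonal g) = Matrix.diagonal fun s : Config m => g (logicalBits q r s) := by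
  have hunit : ∀ a : Register m q r, logicalMatrixUnit a a =
      Matrix.diagonal fun s => if logicalBits q r s = a then 1 else 0 := by
    intro a
    rw [logicalMatrixUnit, logicalFlip_eq_shift, shift_conjTranspose, logicalZeroState_eq_diagonal,
      shift_mul_diagonal_mul_shift]
    congr 1
    funext s
    rw [logicalBits_add, logicalBits_logicalConfig]
    have : logicalBits q r s + a = 0 ↔ logicalBits q r s = a := by
      have ha : a + a = 0 := funext fun _ => fin_two_add_self _
      rw [← ha, add_left_inj]
    simp only [this]
  have hsum : ∀ a : Register m q r,
      ∑ b, Matrix.diagonal g a b • logicalMatrixUnit a b = g a • logicalMatrixUnit (m := m) a a := by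
    intro a
    rw [Finset.sum_eq_single a]
    · rw [Matrix.diagonal_apply_eq]
    · intro b _ hb
      rw [Matrix.diagonal_apply_ne _ hb.symm, zero_smul]
    · simp
  rw [logicalOp, Finset.sum_congr rfl fun a _ => hsum a]
  ext s t
  rw [Matrix.sum_apply]
  simp only [hunit, Matrix.smul_apply, Matrix.diagonal_apply, smul_eq_mul]
  split_ifs with h <;> simp

/-- A logical diagonal operator with entries `±1` maps the code space onto itself. -/
theorem map_codeSpace_diagonal {m q r : ℕ} (g : Register m q r → ℂ) (hg : ∀ b, g b * g b = 1) :
    (codeSpace m q r).map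
      (Matrix.toLin' (Matrix.diagonal fun s : Config m => g (logicalBits q r s))) =
      codeSpace m q r := by
  have hmem : ∀ ψ ∈ codeSpace m q r,
      (Matrix.diagonal fun s : Config m => g (logicalBits q r s)) *ᵥ ψ ∈ codeSpace m q r := by
    intro ψ hψ
    obtain ⟨hX, hZ⟩ := mem_codeSpace_iff.1 hψ
    refine mem_codeSpace_iff.2 ⟨fun x J hJ s => ?_, fun x J hJ s hs => hZ x J hJ s ?_⟩
    · rw [Matrix.mulVec_diagonal, Matrix.mulVec_diagonal, logicalBits_add_indicator s x hJ,
        hX x J hJ s]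
    · rw [Matrix.mulVec_diagonal] at hs
      exact right_ne_zero_of_mul hs
  refine le_antisymm ?_ fun ψ hψ => ?_
  · rintro _ ⟨ψ, hψ, rfl⟩
    exact hmem ψ hψ
  · refine ⟨_, hmem ψ hψ, ?_⟩
    rw [Matrix.toLin'_apply]
    ext s
    rw [Matrix.mulVec_diagonal, Matrix.mulVec_diagonal, ← mul_assoc, hg, one_mul]

theorem controlledZCircuit_eq_diagonal {ι : Type} [Fintype ι] [DecidableEq ι]
    (F : Finset (Finset ι)) :
    controlledZCircuit F = Matrix.diagonal fun b =>
      (-1) ^ (F.filter fun s => s.Nonempty ∧ ∀ i ∈ s, b i = 1).card := by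
  have hM : ∀ s : Finset ι, controlledZ s =
      Matrix.diagonal ((fun s b => if s.Nonempty ∧ ∀ i ∈ s, b i = 1 then -1 else 1 :
        Finset ι → (ι → Fin 2) → ℂ) s) := fun s => rfl
  refine (noncommProd_eq_diagonal F hM _).trans ?_
  congr 1
  funext b
  rw [Finset.prod_ite, Finset.prod_const, Finset.prod_const_one, mul_one]

theorem logicalOp_eq_diagonal_neg_one_pow {m : ℕ} (q r k : ℕ) (K : Finset (Fin m)) :
    logicalOp (controlledZCircuit (minimalCovers q r k K)) =
      Matrix.diagonal fun s : Config m => (-1) ^ ((minimalCovers q r k K).filter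
        fun 𝒥 => 𝒥.Nonempty ∧ ∀ J ∈ 𝒥, logicalBits q r s J = 1).card := by
  rw [controlledZCircuit_eq_diagonal, logicalOp_diagonal]

/-! ### The phase of the signed rotation -/

theorem one_sub_two_mul_eq {m : ℕ} (s : Config m) (X : Finset (Fin m)) :
    1 - 2 * ((s (incidence X) : ℕ) : ℤ) =
      (-1) ^ ((Finset.univ.filter fun J => coeff J s = 1).filter (· ⊆ X)).card := by
  have h0 : ∀ a : Fin 2, 1 - 2 * ((a : ℕ) : ℤ) = (-1) ^ (a : ℕ) := by decide
  have h1 : ∀ a : Fin 2, (-1 : ℤ) ^ (a : ℕ) = if a = 1 then -1 else 1 := by decide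
  rw [h0, ← sum_coeff s X, neg_one_pow_val_sum, Finset.prod_congr rfl fun J _ => h1 (coeff J s),
    Finset.prod_ite, Finset.prod_const, Finset.prod_const_one, mul_one]
  congr 2
  ext J
  simp [and_comm]

/-- On a polynomial of degree at most `r`, the covers of `K` by `k + 1` monomials are the minimal
covers all of whose logical qubits are `1`: a monomial of degree at most `q` is too small. -/
theorem card_covers_eq {m q r k : ℕ} {K : Finset (Fin m)} (hK : q + k * r + 1 ≤ K.card)
    {s : Config m} (hs : ∀ J : Finset (Fin m), r < J.card → coeff J s = 0) :
    ((Finset.univ.filter fun J => coeff J s = 1).powerset.filter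
      fun U => U.biUnion id = K ∧ U.card = k + 1).card =
    ((minimalCovers q r k K).filter
      fun 𝒥 => 𝒥.Nonempty ∧ ∀ J ∈ 𝒥, logicalBits q r s J = 1).card := by
  symm
  refine Finset.card_bij (fun 𝒥 _ => 𝒥.map (Function.Embedding.subtype _)) ?_ ?_ ?_
  · intro 𝒥 h
    simp only [minimalCovers, Finset.mem_filter, Finset.mem_univ, true_and] at h
    obtain ⟨⟨hU, hc⟩, -, h1⟩ := h
    simp only [Finset.mem_filter, Finset.mem_powerset, Finset.card_map]
    refine ⟨fun J hJ => ?_, ?_, hc⟩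
    · obtain ⟨L, hL, rfl⟩ := Finset.mem_map.1 hJ
      exact Finset.mem_filter.2 ⟨Finset.mem_univ _, h1 L hL⟩
    · rw [← hU]
      ext i
      simp
  · intro 𝒥 _ 𝒥' _ h
    exact Finset.map_injective _ h
  · intro U hU
    simp only [Finset.mem_filter, Finset.mem_powerset] at hU
    obtain ⟨h1, hK', hc⟩ := hU
    have hle : ∀ J ∈ U, J.card ≤ r := by
      intro J hJ
      by_contra hlt
      have := (Finset.mem_filter.1 (h1 hJ)).2
      rw [hs J (not_le.1 hlt)] at this
      exact absurd this (by decide)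
    have hge : ∀ J ∈ U, q + 1 ≤ J.card := by
      intro J hJ
      -- The other `k` members of `U` cover at most `k * r` elements of `K`.
      have e : K = J ∪ (U.erase J).biUnion id := by
        rw [← hK', ← Finset.insert_erase hJ, Finset.biUnion_insert]
        simp
      have h2 : ((U.erase J).biUnion id).card ≤ (U.erase J).card * r :=
        Finset.card_biUnion_le_card_mul _ _ _ fun L hL => hle L (Finset.mem_of_mem_erase hL)
      rw [Finset.card_erase_of_mem hJ, hc, Nat.add_sub_cancel] at h2
      have h3 := Finset.card_union_le J ((U.erase J).biUnion id)
      rw [← e] at h3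
      omega
    have hmap : (U.subtype fun J => q + 1 ≤ J.card ∧ J.card ≤ r).map
        (Function.Embedding.subtype _) = U :=
      Finset.subtype_map_of_mem fun J hJ => ⟨hge J hJ, hle J hJ⟩
    refine ⟨U.subtype fun J => q + 1 ≤ J.card ∧ J.card ≤ r, ?_, hmap⟩
    have hc' : (U.subtype fun J => q + 1 ≤ J.card ∧ J.card ≤ r).card = k + 1 := by
      rw [← hc, ← congrArg Finset.card hmap, Finset.card_map]
    simp only [minimalCovers, Finset.mem_filter, Finset.mem_univ, true_and]
    refine ⟨⟨?_, hc'⟩, Finset.card_pos.1 (by omega), fun J hJ => ?_⟩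
    · rw [← hK', ← congrArg (fun V => V.biUnion id) hmap]
      ext i
      simp only [Finset.mem_biUnion, Finset.mem_map, id]
      exact ⟨fun ⟨J, hJ, hi⟩ => ⟨J.1, ⟨J, hJ, rfl⟩, hi⟩, fun ⟨_, ⟨J, hJ, rfl⟩, hi⟩ => ⟨J, hJ, hi⟩⟩
    · exact (Finset.mem_filter.1 (h1 (Finset.mem_subtype.1 hJ))).2

/-- On a polynomial of degree at most `r`, the phase of the signed rotation is the sign that counts
the minimal covers. -/
theorem exp_alternating_sum_eq {m q r k : ℕ} {K : Finset (Fin m)} (hK : q + k * r + 1 ≤ K.card)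
    {s : Config m} (hs : ∀ J : Finset (Fin m), r < J.card → coeff J s = 0) :
    Complex.exp (Complex.I * (Real.pi : ℂ) / (2 : ℂ) ^ k *
      ((∑ x ∈ standardCube K, (-1) ^ hammingNorm x * ((s x : ℕ) : ℤ) : ℤ) : ℂ)) =
    (-1) ^ ((minimalCovers q r k K).filter
      fun 𝒥 => 𝒥.Nonempty ∧ ∀ J ∈ 𝒥, logicalBits q r s J = 1).card := by
  obtain ⟨w, hw⟩ := exists_alternating_sum_eq (Finset.univ.filter fun J => coeff J s = 1) K
    (fun X => ((s (incidence X) : ℕ) : ℤ)) (k := k) (r := r) (one_sub_two_mul_eq s)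
    (fun J hJ => by
      by_contra hlt
      have := (Finset.mem_filter.1 hJ).2
      rw [hs J (not_le.1 hlt)] at this
      exact absurd this (by decide)) (by omega)
  rw [card_covers_eq hK hs] at hw
  simp only [sum_standardCube, hammingNorm_incidence, hw]
  set N := ((minimalCovers q r k K).filter
      fun 𝒥 => 𝒥.Nonempty ∧ ∀ J ∈ 𝒥, logicalBits q r s J = 1).card
  have h2 : (2 : ℂ) ^ k ≠ 0 := pow_ne_zero _ two_ne_zero
  have e : Complex.I * (Real.pi : ℂ) / (2 : ℂ) ^ k * ((2 ^ k * ((N : ℤ) + 2 * w) : ℤ) : ℂ) =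
      (N : ℂ) * (Real.pi * Complex.I) + (w : ℂ) * (2 * Real.pi * Complex.I) := by
    push_cast
    field_simp
  rw [e, Complex.exp_add, Complex.exp_int_mul_two_pi_mul_I, mul_one, Complex.exp_nat_mul,
    Complex.exp_pi_mul_I]

end QRM
end

theorem mainTheorem2 (m q r k : ℕ) (hqr : q ≤ r) (hrm : r ≤ m)
    (K : Finset (Fin m)) (hK : K ∈ QRM.levelIndex m q r k) :
    QRM.LogicallyEquivalent (QRM.codeSpace m q r)
      (QRM.signedZ k (QRM.standardCube K))
      (QRM.logicalOp (QRM.controlledZCircuit (QRM.minimalCovers q r k K))) := by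
  have hV := QRM.logicalOp_eq_diagonal_neg_one_pow q r k K
  have hmap : (QRM.codeSpace m q r).map (Matrix.toLin'
      (QRM.logicalOp (QRM.controlledZCircuit (QRM.minimalCovers q r k K)))) =
      QRM.codeSpace m q r := by
    rw [hV]
    refine QRM.map_codeSpace_diagonal (fun b => (-1) ^ ((QRM.minimalCovers q r k K).filter
      fun 𝒥 => 𝒥.Nonempty ∧ ∀ J ∈ 𝒥, b J = 1).card) fun b => ?_
    rw [← mul_pow, neg_one_mul, neg_neg, one_pow]
  have hact : ∀ ψ ∈ QRM.codeSpace m q r, QRM.signedZ k (QRM.standardCube K) *ᵥ ψ =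
      QRM.logicalOp (QRM.controlledZCircuit (QRM.minimalCovers q r k K)) *ᵥ ψ := by
    intro ψ hψ
    rw [hV, QRM.signedZ_eq_diagonal]
    ext s
    rw [Matrix.mulVec_diagonal, Matrix.mulVec_diagonal]
    by_cases hs : ψ s = 0
    · rw [hs, mul_zero, mul_zero]
    · rw [QRM.exp_alternating_sum_eq hK.1 fun J hJ =>
        QRM.coeff_eq_zero_of_mem_codeSpace hψ hs hJ]
  exact ⟨(SetLike.coe_injective (Set.image_congr hact)).trans hmap, hmap, hact⟩
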